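/- Let $\mathbb{L}/\mathbb{K}$ be a cyclic Galois extension of fields of finite degree $n$, let $\sigma$ be a generator of $\mathrm{Gal}(\mathbb{L}/\mathbb{K})$, and let $R=\mathbb{L}[x;\sigma]$ be the skew polynomial ring with multiplication determined by $xa=\sigma(a)x$ for $a\in\mathbb{L}$. Let $f=x^h+f_{h-1}x^{h-1}+\cdots+f_0\in R$ be a monic irreducible element of degree $h$ with $f_0\neq 0$, and let $F(y)\in\mathbb{K}[y]$ be the monic polynomial such that $F(x^n)$ is the bound of $f$; that is, $F(x^n)$ is two-sided (where $g\in R$ is called two-sided if $Rg=gR$) and $RF(x^n)$ is the largest two-sided ideal of $R$ contained in $Rf$. Let $\phi_f:R/Rf\to R/Rf$ be the $\sigma$-semilinear map $v\mapsto xv$, so that $\phi_f^n$ is $\mathbb{L}$-linear. Let $$C_f=\begin{pmatrix}0&0&\cdots&0&-f_0\\1&0&\cdots&0&-f_1\\ \vdots&\ddots&&\vdots&\vdots\\0&0&\cdots&1&-f_{h-1}\end{pmatrix}\in \mathbb{L}^{h\times h},\qquad A_f=C_f\,C_f^{\sigma}\cdots C_f^{\sigma^{n-1}},$$ where $\sigma$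 acts entrywise on matrices. Then: (i) $\phi_f^n$ has a minimal polynomial as a $\mathbb{K}$-linear map, and this polynomial, viewed in $\mathbb{L}[y]$, equals the minimal polynomial of $\phi_f^n$ as an $\mathbb{L}$-linear map. (ii) $F(x^n)$ is a product of irreducible elements of $R$, the number $m$ of factors is the same for all such factorisations, $m$ divides $n$, and, with $\ell=n/m$, the characteristic polynomial $\det(yI-A_f)$ of $A_f$ equals $F(y)^{\ell}$. (iii) If $\mathbb{K}$ is finite, then $\ell=1$. -/

import Mathlib

noncomputable section

section SkewRing

variable {K L : Type*} [Field K] [Field L] [Algebra K L]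

/-- The action of the additive monoid of natural numbers (written multiplicatively) on `L` in which
`1` acts as the automorphism `σ`. -/
abbrev skewAction (σ : L ≃ₐ[K] L) : MulSemiringAction (Multiplicative ℕ) L :=
  MulSemiringAction.compHom L (powersHom (L ≃ₐ[K] L) σ)

/-- The skew polynomial ring `L[x; σ]`, whose elements are the polynomials `∑ aᵢ xⁱ` with
coefficients `aᵢ ∈ L` on the left, and in which `x a = σ(a) x`. -/
def SkewRing (_σ : L ≃ₐ[K] L) : Type _ := SkewPolynomial L

namespace SkewRing

variable {σ : L ≃ₐ[K] L}

instance instRing : Ring (SkewRing σ) :=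
  letI := skewAction σ
  inferInstanceAs (Ring (SkewPolynomial L))

/-- The constants, `L → L[x; σ]`. -/
def C : L →+* SkewRing σ :=
  letI := skewAction σ
  (SkewPolynomial.CRingHom : L →+* SkewPolynomial L)

/-- The indeterminate `x`. -/
def X : SkewRing σ := (SkewPolynomial.X : SkewPolynomial L)

/-- The coefficient of `xⁱ`. -/
def coeff (f : SkewRing σ) (i : ℕ) : L := SkewPolynomial.coeff (R := L) f i

/-- The commutation rule of the skew polynomial ring. -/
theorem X_mul_C (a : L) : (X : SkewRing σ) * C a = C (σ a) * X := by
  let := skewAction σ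
  have key : (SkewPolynomial.X : SkewPolynomial L) * SkewPolynomial.CRingHom a
      = SkewPolynomial.CRingHom (σ a) * SkewPolynomial.X := by
    rw [SkewPolynomial.CRingHom_eq_C, SkewPolynomial.CRingHom_eq_C,
      SkewPolynomial.C_mul_X_eq_monomial, ← SkewPolynomial.monomial_zero_left,
      SkewPolynomial.X_mul_monomial]
    rfl
  exact key

/-- `L` acts on `L[x; σ]` by left multiplication by constants. -/
instance instModule : Module L (SkewRing σ) := Module.compHom (SkewRing σ) (C : L →+* SkewRing σ)

/-- `K ⊆ L` acts on `L[x; σ]` by left multiplication by constants. -/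
instance instModuleBase : Module K (SkewRing σ) :=
  Module.compHom (SkewRing σ) ((C : L →+* SkewRing σ).comp (algebraMap K L))

theorem smul_def (a : L) (f : SkewRing σ) : a • f = C a * f := rfl

theorem smul_base_def (a : K) (f : SkewRing σ) : a • f = C (algebraMap K L a) * f := rfl

instance : IsScalarTower L (SkewRing σ) (SkewRing σ) :=
  ⟨fun a f g => by simp only [smul_def, smul_eq_mul, mul_assoc]⟩

instance : IsScalarTower K (SkewRing σ) (SkewRing σ) :=
  ⟨fun a f g => by simp only [smul_base_def, smul_eq_mul, mul_assoc]⟩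

instance : IsScalarTower K L (SkewRing σ) :=
  ⟨fun a b f => by simp only [smul_def, smul_base_def, Algebra.smul_def, map_mul, mul_assoc]⟩

/-- `f` is monic of degree `h`. -/
def IsMonicOfDegree (f : SkewRing σ) (h : ℕ) : Prop :=
  f.coeff h = 1 ∧ ∀ i, h < i → f.coeff i = 0

/-- The element `F(xⁿ)` of `L[x; σ]`, for `F ∈ K[y]` and `n = [L : K]`. -/
def central (σ : L ≃ₐ[K] L) (F : Polynomial K) : SkewRing σ :=
  F.eval₂ ((C : L →+* SkewRing σ).comp (algebraMap K L)) (X ^ Module.finrank K L)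

/-- The left ideal `Rf` of `R = L[x; σ]`. -/
abbrev leftIdeal (f : SkewRing σ) : Ideal (SkewRing σ) := Ideal.span {f}

/-- An element `g` of `R = L[x; σ]` is two-sided if `Rg = gR`. -/
def IsTwoSidedElement (g : SkewRing σ) : Prop :=
  {p : SkewRing σ | ∃ r, p = r * g} = {p : SkewRing σ | ∃ r, p = g * r}

/-- `g` is a bound of `f`: it is two-sided, and `Rg` is the largest two-sided ideal of `R`
contained in `Rf`. -/
def IsBound (f g : SkewRing σ) : Prop :=
  IsTwoSidedElement g ∧ leftIdeal g ≤ leftIdeal f ∧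
    ∀ I : Ideal (SkewRing σ), I.IsTwoSided → I ≤ leftIdeal f → I ≤ leftIdeal g

/-- The list `l` is a factorisation of `g` into irreducible elements of `L[x; σ]`. -/
def IsIrreducibleFactorization (g : SkewRing σ) (l : List (SkewRing σ)) : Prop :=
  (∀ p ∈ l, Irreducible p) ∧ l.prod = g

/-- The number of irreducible factors of `g` in `L[x; σ]` is (well defined and equal to) `m`. -/
def IsNumIrreducibleFactors (g : SkewRing σ) (m : ℕ) : Prop :=
  (∃ l, IsIrreducibleFactorization g l) ∧ ∀ l, IsIrreducibleFactorization g l → l.length = m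

/-- The `σ`-semilinear map `φ_f : R/Rf → R/Rf`, `v ↦ xv`. -/
def phi (f : SkewRing σ) :
    (SkewRing σ ⧸ leftIdeal f) →ₛₗ[(σ : L →+* L)] (SkewRing σ ⧸ leftIdeal f) where
  toFun v := (X : SkewRing σ) • v
  map_add' := smul_add _
  map_smul' a v := by
    have key : ∀ (b : L) (w : SkewRing σ ⧸ leftIdeal f), b • w = (C b : SkewRing σ) • w := by
      intro b w
      induction w using Submodule.Quotient.induction_on with
      | _ r => rfl
    rw [key, key, ← mul_smul, X_mul_C, mul_smul]
    rfl

theorem phi_iterate_smul (f : SkewRing σ) (k : ℕ) (a : L) (v : SkewRing σ ⧸ leftIdeal f) :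
    (phi f)^[k] (a • v) = (σ ^ k) a • (phi f)^[k] v := by
  induction k with
  | zero => simp
  | succ k ih =>
    rw [Function.iterate_succ_apply', Function.iterate_succ_apply', ih, map_smulₛₗ, pow_succ']
    rfl

theorem pow_finrank_eq_one [FiniteDimensional K L] [IsGalois K L] (σ : L ≃ₐ[K] L) :
    σ ^ Module.finrank K L = 1 := by
  rw [← IsGalois.card_aut_eq_finrank]
  exact pow_card_eq_one'

/-- The map `φ_fⁿ`, `n = [L : K]`, as an `L`-linear endomorphism of `R/Rf`. -/
def phiPow [FiniteDimensional K L] [IsGalois K L] (f : SkewRing σ) :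
    Module.End L (SkewRing σ ⧸ leftIdeal f) where
  toFun := (phi f)^[Module.finrank K L]
  map_add' := iterate_map_add (phi f) _
  map_smul' a v := by
    rw [phi_iterate_smul, pow_finrank_eq_one]
    rfl

/-- The map `φ_fⁿ`, `n = [L : K]`, as a `K`-linear endomorphism of `R/Rf`. -/
def phiPowBase [FiniteDimensional K L] [IsGalois K L] (f : SkewRing σ) :
    Module.End K (SkewRing σ ⧸ leftIdeal f) :=
  (phiPow f).restrictScalars K

/-- The companion matrix `C_f` of a monic `f = x^h + ∑_{i<h} f_i x^i`: ones below the diagonal,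
last column `-f_0, …, -f_{h-1}`, zeros elsewhere. -/
def companion (f : SkewRing σ) (h : ℕ) : Matrix (Fin h) (Fin h) L :=
  Matrix.of fun i j =>
    if (j : ℕ) + 1 = h then -f.coeff i else if (i : ℕ) = j + 1 then 1 else 0

/-- The matrix `A_f = C_f C_f^σ ⋯ C_f^{σ^{n-1}}`, `n = [L : K]`, with `σ` acting entrywise. -/
def matA (f : SkewRing σ) (h : ℕ) : Matrix (Fin h) (Fin h) L :=
  ((List.range (Module.finrank K L)).map fun i => (companion f h).map ⇑(σ ^ i)).prod

end SkewRing

end SkewRing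

end

/-!
Write `R = L[x; σ]`, `M = R/Rf`, `n = [L : K]` and `d = deg F`. Right division with remainder makes
every left ideal of `R` principal (`exists_eq_leftIdeal`), so `M` is a simple `R`-module with
`L`-basis `1, x, …, x^{h-1}` (`isSimpleModule_quotient`, `powerBasis`). The elements of `K[xⁿ]` are
central in `R`, and `xⁿ` commutes with `L`. The annihilator of `M` is the largest two-sided ideal
contained in `Rf`, that is `RF(xⁿ)` (`smul_quotient_eq_zero_iff`).

For `G ∈ L[y]` the operator `G(φ_fⁿ)` is multiplication by `G(xⁿ)` on `M`. It vanishes exactly when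
`G(xⁿ) ∈ RF(xⁿ)`, and by division in `L[y]` exactly when `F ∣ G`
(`evalXPow_mem_leftIdeal`). Hence `F` is the minimal polynomial of `φ_fⁿ` over `K` and over `L`
(`minpoly_phiPow`, `minpoly_phiPowBase`).

By Schur's lemma `D = End_R(M)` is a division algebra. It contains `φ_fⁿ`, so `F` is irreducible
over `K` (`irreducible_of_isBound`) and `dim_K D = d c` for an integer `c`. Letting `R/RF(xⁿ)` act
on a `K`-basis of `M` embeds it into a power of `M`, so it is isomorphic to some `M^m`
(`exists_linearEquiv_fun`). The module length is additive on products in `R`, and `R/Rp` has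
length one for `p` irreducible; hence every factorisation of `F(xⁿ)` has `m` factors
(`IsIrreducibleFactorization.length_quotient`). Comparing `L`-dimensions gives `n d = m h`, and
`M ≅ Hom_R(R/RF(xⁿ), M) ≅ D^m` gives `n h = m d c`. Thus `n² = m² c`, so `m ∣ n`, and with `ℓ = n/m`
one has `h = d ℓ` and `c = ℓ²`.

The matrix of `φ_fⁿ` in the basis `1, x, …, x^{h-1}` is `A_f` (`toMatrix_phiPow`). Cyclically
permuting the factors of `A_f` gives `A_f^σ`, so the characteristic polynomial of `A_f` is fixed by
`σ` and has coefficients in `K`. It divides a power of `F`, because `F(A_f) = 0`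
(`Matrix.charpoly_dvd_pow_of_aeval_eq_zero`). As `F` is irreducible, the characteristic polynomial
is itself a power of `F`, and its degree `h = d ℓ` shows that it is `F^ℓ`.

If `K` is finite, then `D` is commutative by Wedderburn's little theorem, so `D` acts on `M` by
elements of `End_D(M)`, and a dimension count shows that `R` maps onto `End_D(M)`
(`exists_mem_forall_eq_smul_of_finite`). So each element of `D` acts as some `r ∈ R` that commutes
with `R` modulo `RF(xⁿ)`. Such an `r`, reduced modulo `F(xⁿ)`, lies in `K[xⁿ]`
(`exists_eq_central_of_commutator_mem`). Hence `D = K[φ_fⁿ]` has dimension `d`, that is `ℓ² = 1`.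
-/

noncomputable section

namespace SkewRing

/-! ### Coefficients of skew polynomials -/

section Coefficients

variable {K L : Type*} [Field K] [Field L] [Algebra K L] {σ : L ≃ₐ[K] L}

@[ext]
theorem ext {f g : SkewRing σ} (h : ∀ i, f.coeff i = g.coeff i) : f = g :=
  SkewPolynomial.ext h

@[simp]
theorem coeff_zero (i : ℕ) : (0 : SkewRing σ).coeff i = 0 :=
  SkewPolynomial.coeff_zero i

@[simp]
theorem coeff_add (f g : SkewRing σ) (i : ℕ) : (f + g).coeff i = f.coeff i + g.coeff i :=
  SkewPolynomial.coeff_add f g i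

@[simp]
theorem coeff_neg (f : SkewRing σ) (i : ℕ) : (-f).coeff i = -f.coeff i := by
  rw [eq_neg_iff_add_eq_zero, ← coeff_add, neg_add_cancel, coeff_zero]

@[simp]
theorem coeff_sub (f g : SkewRing σ) (i : ℕ) : (f - g).coeff i = f.coeff i - g.coeff i := by
  rw [sub_eq_add_neg, coeff_add, coeff_neg, sub_eq_add_neg]

theorem coeff_C_mul_X_pow (a : L) (i k : ℕ) :
    (C a * X ^ i : SkewRing σ).coeff k = if i = k then a else 0 := by
  let := skewAction σ
  have key : SkewPolynomial.coeff (SkewPolynomial.C a * SkewPolynomial.X ^ i) k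
      = if i = k then a else 0 := by
    rw [SkewPolynomial.C_mul_X_pow_eq_monomial, SkewPolynomial.coeff_monomial]
  exact key

theorem coeff_C (a : L) (k : ℕ) : (C a : SkewRing σ).coeff k = if 0 = k then a else 0 := by
  simpa using coeff_C_mul_X_pow (σ := σ) a 0 k

theorem coeff_X_pow (i k : ℕ) : (X ^ i : SkewRing σ).coeff k = if i = k then 1 else 0 := by
  simpa using coeff_C_mul_X_pow (σ := σ) 1 i k

theorem coeff_one (k : ℕ) : (1 : SkewRing σ).coeff k = if 0 = k then 1 else 0 := by
  simpa using coeff_X_pow (σ := σ) 0 k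

@[elab_as_elim]
theorem induction {motive : SkewRing σ → Prop} (f : SkewRing σ)
    (monomial : ∀ a i, motive (C a * X ^ i))
    (add : ∀ f g, motive f → motive g → motive (f + g)) : motive f := by
  let := skewAction σ
  have h0 : motive 0 := by simpa using monomial 0 0
  refine SkewPolynomial.induction (motive := motive) f h0 fun i a q _ _ hq => add _ _ ?_ hq
  rw [← SkewPolynomial.C_mul_X_pow_eq_monomial]
  exact monomial a i

theorem X_pow_mul_C (i : ℕ) (a : L) : (X : SkewRing σ) ^ i * C a = C ((σ ^ i) a) * X ^ i := by
  induction i with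
  | zero => simp
  | succ i ih =>
    rw [pow_succ', mul_assoc, ih, ← mul_assoc, X_mul_C, mul_assoc, ← pow_succ', pow_succ' σ]
    rfl

theorem coeff_C_mul (a : L) (f : SkewRing σ) (k : ℕ) : (C a * f).coeff k = a * f.coeff k := by
  induction f using SkewRing.induction with
  | monomial b i => rw [← mul_assoc, ← map_mul, coeff_C_mul_X_pow, coeff_C_mul_X_pow]; simp
  | add f g hf hg => simp [mul_add, hf, hg]

@[simp]
theorem coeff_smul (a : L) (f : SkewRing σ) (k : ℕ) : (a • f).coeff k = a * f.coeff k :=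
  coeff_C_mul a f k

theorem coeff_mul (f g : SkewRing σ) (k : ℕ) :
    (f * g).coeff k =
      ∑ p ∈ Finset.HasAntidiagonal.antidiagonal k, f.coeff p.1 * (σ ^ p.1) (g.coeff p.2) := by
  induction f using SkewRing.induction with
  | add f₁ f₂ h₁ h₂ => simp [add_mul, h₁, h₂, Finset.sum_add_distrib]
  | monomial a i =>
    induction g using SkewRing.induction with
    | add g₁ g₂ h₁ h₂ => simp [mul_add, h₁, h₂, Finset.sum_add_distrib]
    | monomial b j =>
      have : (C a * X ^ i * (C b * X ^ j) : SkewRing σ) = C (a * (σ ^ i) b) * X ^ (i + j) := by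
        rw [mul_assoc, ← mul_assoc (X ^ i), X_pow_mul_C, map_mul, pow_add]
        simp only [mul_assoc]
      rw [this, coeff_C_mul_X_pow]
      simp only [coeff_C_mul_X_pow]
      have hzero (p q : ℕ) (h : (p, q) ≠ (i, j)) :
          (if i = p then a else 0) * (σ ^ p) (if j = q then b else 0) = 0 := by
        by_cases hp : i = p
        · have hq : j ≠ q := by rintro rfl; exact h (by rw [hp])
          rw [if_neg hq, map_zero, mul_zero]
        · rw [if_neg hp, zero_mul]
      split_ifs with h
      · rw [Finset.sum_eq_single (i, j) (fun p _ => hzero p.1 p.2) (fun hn =>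
          absurd (Finset.HasAntidiagonal.mem_antidiagonal.2 h) hn)]
        simp
      · refine (Finset.sum_eq_zero fun p hp => hzero p.1 p.2 ?_).symm
        intro he
        rw [show p = (i, j) from he] at hp
        exact h (Finset.HasAntidiagonal.mem_antidiagonal.1 hp)

theorem coeff_mul_X (f : SkewRing σ) (k : ℕ) : (f * X).coeff (k + 1) = f.coeff k := by
  have := coeff_X_pow (σ := σ) 1
  rw [pow_one] at this
  rw [coeff_mul, Finset.sum_eq_single (k, 1)]
  · simp [this]
  · rintro ⟨p, q⟩ hp hne
    rw [Finset.HasAntidiagonal.mem_antidiagonal] at hp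
    have : 1 ≠ q := by rintro rfl; apply hne; ext <;> simp at *; omega
    simp [*]
  · simp

theorem coeff_X_mul (f : SkewRing σ) (k : ℕ) : (X * f).coeff (k + 1) = σ (f.coeff k) := by
  have := coeff_X_pow (σ := σ) 1
  rw [pow_one] at this
  rw [coeff_mul, Finset.sum_eq_single (1, k)]
  · simp [this]
  · rintro ⟨p, q⟩ hp hne
    rw [Finset.HasAntidiagonal.mem_antidiagonal] at hp
    have : 1 ≠ p := by rintro rfl; apply hne; ext <;> simp at *; omega
    simp [*]
  · simp; omega

theorem coeff_mul_C (f : SkewRing σ) (a : L) (k : ℕ) :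
    (f * C a).coeff k = f.coeff k * (σ ^ k) a := by
  rw [coeff_mul, Finset.sum_eq_single (k, 0)]
  · simp [coeff_C]
  · rintro ⟨p, q⟩ hp hne
    rw [Finset.HasAntidiagonal.mem_antidiagonal] at hp
    have : 0 ≠ q := by rintro rfl; apply hne; ext <;> simp at *; omega
    simp [coeff_C, this]
  · simp

/-- The coefficient of `xⁱ` as an `L`-linear form. -/
def coeffLinear (σ : L ≃ₐ[K] L) (i : ℕ) : SkewRing σ →ₗ[L] L where
  toFun f := f.coeff i
  map_add' f g := coeff_add f g i
  map_smul' a f := coeff_smul a f i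

@[simp]
theorem coeffLinear_apply (f : SkewRing σ) (i : ℕ) : coeffLinear σ i f = f.coeff i := rfl

theorem coeff_sum {ι : Type*} (s : Finset ι) (f : ι → SkewRing σ) (i : ℕ) :
    (∑ j ∈ s, f j).coeff i = ∑ j ∈ s, (f j).coeff i :=
  map_sum (coeffLinear σ i) f s

end Coefficients

/-! ### Degree and right division -/

section Degree

variable {K L : Type*} [Field K] [Field L] [Algebra K L] {σ : L ≃ₐ[K] L}

/-- The `L`-subspace of the skew polynomials of degree less than `k`. -/
def degreeLT (σ : L ≃ₐ[K] L) (k : ℕ) : Submodule L (SkewRing σ) :=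
  ⨅ i : {i // k ≤ i}, LinearMap.ker (coeffLinear σ i)

theorem mem_degreeLT {f : SkewRing σ} {k : ℕ} :
    f ∈ degreeLT σ k ↔ ∀ i, k ≤ i → f.coeff i = 0 := by
  simp [degreeLT]

theorem degreeLT_mono {j k : ℕ} (h : j ≤ k) : degreeLT σ j ≤ degreeLT σ k := fun _ hf =>
  mem_degreeLT.2 fun i hi => mem_degreeLT.1 hf i (h.trans hi)

@[simp]
theorem mem_degreeLT_zero {f : SkewRing σ} : f ∈ degreeLT σ 0 ↔ f = 0 :=
  ⟨fun h => ext fun i => by simpa using mem_degreeLT.1 h i (Nat.zero_le i),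
    fun h => h ▸ Submodule.zero_mem _⟩

theorem exists_mem_degreeLT (f : SkewRing σ) : ∃ k, f ∈ degreeLT σ k := by
  induction f using SkewRing.induction with
  | monomial a i =>
    refine ⟨i + 1, mem_degreeLT.2 fun k hk => ?_⟩
    rw [coeff_C_mul_X_pow, if_neg (by omega)]
  | add f g hf hg =>
    obtain ⟨j, hj⟩ := hf
    obtain ⟨k, hk⟩ := hg
    exact ⟨max j k, Submodule.add_mem _ (degreeLT_mono (le_max_left _ _) hj)
      (degreeLT_mono (le_max_right _ _) hk)⟩

theorem eq_sum_of_mem_degreeLT {f : SkewRing σ} {k : ℕ} (hf : f ∈ degreeLT σ k) :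
    f = ∑ i ∈ Finset.range k, f.coeff i • X ^ i := by
  ext j
  simp only [coeff_sum, coeff_smul, coeff_X_pow, mul_ite, mul_one, mul_zero, Finset.sum_ite_eq',
    Finset.mem_range]
  split_ifs with h
  · rfl
  · exact mem_degreeLT.1 hf j (not_lt.1 h)

/-- `f` has degree `k` if its `k`-th coefficient is its last nonzero one; the zero polynomial has no
degree. -/
def HasDegree (f : SkewRing σ) (k : ℕ) : Prop :=
  f.coeff k ≠ 0 ∧ f ∈ degreeLT σ (k + 1)

theorem HasDegree.ne_zero {f : SkewRing σ} {k : ℕ} (h : f.HasDegree k) : f ≠ 0 := by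
  rintro rfl
  exact h.1 (coeff_zero k)

theorem HasDegree.lt_of_mem {f : SkewRing σ} {j k : ℕ} (h : f.HasDegree j)
    (hf : f ∈ degreeLT σ k) : j < k := by
  by_contra! hle
  exact h.1 (mem_degreeLT.1 hf j hle)

theorem HasDegree.unique {f : SkewRing σ} {j k : ℕ} (hj : f.HasDegree j) (hk : f.HasDegree k) :
    j = k :=
  le_antisymm (Nat.lt_succ_iff.1 (hj.lt_of_mem hk.2)) (Nat.lt_succ_iff.1 (hk.lt_of_mem hj.2))

theorem exists_hasDegree_of_mem_degreeLT {f : SkewRing σ} {k : ℕ} (hf : f ≠ 0)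
    (hk : f ∈ degreeLT σ k) : ∃ j < k, f.HasDegree j := by
  induction k with
  | zero => exact absurd (mem_degreeLT_zero.1 hk) hf
  | succ k ih =>
    by_cases h : f.coeff k = 0
    · obtain ⟨j, hj, hj'⟩ := ih (mem_degreeLT.2 fun i hi => by
        rcases hi.eq_or_lt with rfl | hi
        · exact h
        · exact mem_degreeLT.1 hk i hi)
      exact ⟨j, hj.trans (Nat.lt_succ_self k), hj'⟩
    · exact ⟨k, Nat.lt_succ_self k, h, hk⟩

theorem exists_hasDegree {f : SkewRing σ} (hf : f ≠ 0) : ∃ k, f.HasDegree k := by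
  obtain ⟨k, hk⟩ := exists_mem_degreeLT f
  obtain ⟨j, -, hj⟩ := exists_hasDegree_of_mem_degreeLT hf hk
  exact ⟨j, hj⟩

theorem IsMonicOfDegree.hasDegree {f : SkewRing σ} {k : ℕ} (h : f.IsMonicOfDegree k) :
    f.HasDegree k :=
  ⟨by rw [h.1]; exact one_ne_zero, mem_degreeLT.2 fun i hi => h.2 i hi⟩

theorem coeff_mul_of_mem_degreeLT {f g : SkewRing σ} {j k : ℕ} (hf : f ∈ degreeLT σ (j + 1))
    (hg : g ∈ degreeLT σ (k + 1)) :
    (f * g).coeff (j + k) = f.coeff j * (σ ^ j) (g.coeff k) := by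
  rw [coeff_mul, Finset.sum_eq_single (j, k)]
  · rintro ⟨p, q⟩ hp hne
    rw [Finset.HasAntidiagonal.mem_antidiagonal] at hp
    dsimp only at hp ⊢
    rcases lt_trichotomy p j with h | rfl | h
    · rw [mem_degreeLT.1 hg q (by omega)]; simp
    · obtain rfl : q = k := by omega
      exact absurd rfl hne
    · rw [mem_degreeLT.1 hf p (by omega)]; simp
  · simp

theorem mul_mem_degreeLT {f g : SkewRing σ} {j k : ℕ} (hf : f ∈ degreeLT σ (j + 1))
    (hg : g ∈ degreeLT σ (k + 1)) : f * g ∈ degreeLT σ (j + k + 1) := by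
  refine mem_degreeLT.2 fun i hi => ?_
  rw [coeff_mul]
  refine Finset.sum_eq_zero ?_
  rintro ⟨p, q⟩ hp
  rw [Finset.HasAntidiagonal.mem_antidiagonal] at hp
  dsimp only at hp ⊢
  rcases lt_or_ge j p with h | h
  · rw [mem_degreeLT.1 hf p (by omega)]; simp
  · rw [mem_degreeLT.1 hg q (by omega)]; simp

theorem HasDegree.mul {f g : SkewRing σ} {j k : ℕ} (hf : f.HasDegree j) (hg : g.HasDegree k) :
    (f * g).HasDegree (j + k) := by
  refine ⟨?_, mul_mem_degreeLT hf.2 hg.2⟩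
  rw [coeff_mul_of_mem_degreeLT hf.2 hg.2]
  exact mul_ne_zero hf.1 ((map_ne_zero _).2 hg.1)

theorem hasDegree_one : (1 : SkewRing σ).HasDegree 0 :=
  ⟨by simp [coeff_one], mem_degreeLT.2 fun i hi => by rw [coeff_one, if_neg (by omega)]⟩

instance : Nontrivial (SkewRing σ) := ⟨⟨1, 0, hasDegree_one.ne_zero⟩⟩

instance : NoZeroDivisors (SkewRing σ) where
  eq_zero_or_eq_zero_of_mul_eq_zero {f g} h := by
    by_contra! hne
    obtain ⟨j, hj⟩ := exists_hasDegree hne.1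
    obtain ⟨k, hk⟩ := exists_hasDegree hne.2
    exact (hj.mul hk).ne_zero h

instance : IsDomain (SkewRing σ) := NoZeroDivisors.to_isDomain _

theorem isUnit_C {a : L} (ha : a ≠ 0) : IsUnit (C a : SkewRing σ) :=
  (isUnit_iff_ne_zero.2 ha).map C

theorem hasDegree_zero_iff_isUnit {f : SkewRing σ} : f.HasDegree 0 ↔ IsUnit f := by
  constructor
  · intro h
    have : f = C (f.coeff 0) := by
      simpa [smul_def] using eq_sum_of_mem_degreeLT h.2
    rw [this]
    exact isUnit_C h.1
  · rintro ⟨u, rfl⟩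
    obtain ⟨j, hj⟩ := exists_hasDegree (Units.ne_zero u)
    obtain ⟨k, hk⟩ := exists_hasDegree (Units.ne_zero u⁻¹)
    have : j + k = 0 := (by simpa using hj.mul hk : (1 : SkewRing σ).HasDegree (j + k)).unique
      hasDegree_one
    rwa [show j = 0 by omega] at hj

/-- Right division with remainder: subtracting a left multiple of `f` clears the coefficients of
degree at least `deg f`. -/
theorem exists_eq_mul_add {f : SkewRing σ} {k : ℕ} (hf : f.HasDegree k) (g : SkewRing σ) :
    ∃ q r, r ∈ degreeLT σ k ∧ g = q * f + r := by
  obtain ⟨j, hj⟩ := exists_mem_degreeLT g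
  induction j generalizing g with
  | zero => exact ⟨0, g, degreeLT_mono (Nat.zero_le k) hj, by simp⟩
  | succ j ih =>
    rcases lt_or_ge j k with h | h
    · exact ⟨0, g, degreeLT_mono h hj, by simp⟩
    obtain ⟨i, rfl⟩ := Nat.exists_eq_add_of_le' h
    -- `xⁱ f` has leading coefficient `σⁱ(lc f)`
    set c : SkewRing σ := C (g.coeff (i + k) * ((σ ^ i) (f.coeff k))⁻¹) * X ^ i with hc
    have hcdeg : c ∈ degreeLT σ (i + 1) := mem_degreeLT.2 fun l hl => by
      rw [hc, coeff_C_mul_X_pow, if_neg (by omega)]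
    obtain ⟨q, r, hr, hqr⟩ := ih (g - c * f) (mem_degreeLT.2 fun l hl => by
      rcases hl.eq_or_lt with rfl | hl
      · rw [coeff_sub, coeff_mul_of_mem_degreeLT hcdeg hf.2, hc, coeff_C_mul_X_pow, if_pos rfl,
          mul_assoc, inv_mul_cancel₀ ((map_ne_zero _).2 hf.1), mul_one, sub_self]
      · rw [coeff_sub, mem_degreeLT.1 hj l hl,
          mem_degreeLT.1 (mul_mem_degreeLT hcdeg hf.2) l hl, sub_zero])
    exact ⟨q + c, r, hr, by rw [add_mul, add_right_comm, ← hqr, sub_add_cancel]⟩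

theorem eq_zero_of_mul_mem_degreeLT {f q : SkewRing σ} {k : ℕ} (hf : f.HasDegree k)
    (h : q * f ∈ degreeLT σ k) : q = 0 := by
  by_contra hq
  obtain ⟨j, hj⟩ := exists_hasDegree hq
  have := (hj.mul hf).lt_of_mem h
  omega

end Degree

/-! ### Left ideals and factorisations -/

section Ideals

variable {K L : Type*} [Field K] [Field L] [Algebra K L] {σ : L ≃ₐ[K] L}

theorem mem_leftIdeal {f g : SkewRing σ} : g ∈ leftIdeal f ↔ ∃ q, q * f = g :=
  Ideal.mem_span_singleton'

/-- Every left ideal of `L[x; σ]` is principal. -/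
theorem exists_eq_leftIdeal (I : Ideal (SkewRing σ)) : ∃ g, I = leftIdeal g := by
  classical
  by_cases hI : I = ⊥
  · exact ⟨0, by simp [hI, leftIdeal]⟩
  have hex : ∃ k, ∃ g ∈ I, g.HasDegree k := by
    obtain ⟨g, hg, hg0⟩ := Submodule.exists_mem_ne_zero_of_ne_bot hI
    obtain ⟨k, hk⟩ := exists_hasDegree hg0
    exact ⟨k, g, hg, hk⟩
  obtain ⟨g, hg, hdeg⟩ := Nat.find_spec hex
  refine ⟨g, le_antisymm (fun a ha => ?_) ((Ideal.span_singleton_le_iff_mem I).2 hg)⟩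
  obtain ⟨q, r, hr, hqr⟩ := exists_eq_mul_add hdeg a
  by_cases hr0 : r = 0
  · exact mem_leftIdeal.2 ⟨q, by rw [hqr, hr0, add_zero]⟩
  obtain ⟨j, hj, hj'⟩ := exists_hasDegree_of_mem_degreeLT hr0 hr
  refine absurd ⟨r, ?_, hj'⟩ (Nat.find_min hex hj)
  rw [← sub_eq_of_eq_add' hqr]
  exact I.sub_mem ha (I.mul_mem_left q hg)

theorem leftIdeal_eq_top_iff {f : SkewRing σ} : leftIdeal f = ⊤ ↔ IsUnit f := by
  rw [Ideal.eq_top_iff_one, mem_leftIdeal]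
  refine ⟨fun ⟨q, hq⟩ => ?_, fun ⟨u, hu⟩ => ⟨↑u⁻¹, by simp [← hu]⟩⟩
  exact IsUnit.of_mul_eq_one_right q hq

/-- For irreducible `p` the left module `R/Rp` is simple. -/
theorem isSimpleModule_quotient {p : SkewRing σ} (hp : Irreducible p) :
    IsSimpleModule (SkewRing σ) (SkewRing σ ⧸ leftIdeal p) := by
  rw [isSimpleModule_iff_isCoatom, isCoatom_iff_ge_of_le]
  refine ⟨fun h => hp.not_isUnit (leftIdeal_eq_top_iff.1 h), fun I hI hle => ?_⟩
  obtain ⟨g, rfl⟩ := exists_eq_leftIdeal I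
  obtain ⟨q, hq⟩ := mem_leftIdeal.1 (hle (Ideal.mem_span_singleton_self p))
  rcases hp.isUnit_or_isUnit hq.symm with ⟨u, rfl⟩ | h
  · refine (Ideal.span_singleton_le_iff_mem _).2 (mem_leftIdeal.2 ⟨↑u⁻¹, ?_⟩)
    rw [← hq, ← mul_assoc, Units.inv_mul, one_mul]
  · exact absurd (leftIdeal_eq_top_iff.2 h) hI

/-- The submodule `Rq/Rpq` of `R/Rpq` is `R/Rp`, and its quotient is `R/Rq`. -/
theorem length_quotient_mul (p : SkewRing σ) {q : SkewRing σ} (hq : q ≠ 0) :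
    Module.length (SkewRing σ) (SkewRing σ ⧸ leftIdeal (p * q)) =
      Module.length (SkewRing σ) (SkewRing σ ⧸ leftIdeal p) +
        Module.length (SkewRing σ) (SkewRing σ ⧸ leftIdeal q) := by
  let r : SkewRing σ →ₗ[SkewRing σ] SkewRing σ := LinearMap.toSpanSingleton _ _ q
  have hr (a) : r a = a * q := rfl
  have hcomap : leftIdeal p = Submodule.comap r (leftIdeal (p * q)) := by
    ext a
    rw [Submodule.mem_comap, hr, mem_leftIdeal, mem_leftIdeal]
    exact exists_congr fun b => by rw [← mul_assoc, mul_left_inj' hq]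
  have hle : leftIdeal (p * q) ≤ leftIdeal q :=
    (Ideal.span_singleton_le_iff_mem _).2 (mem_leftIdeal.2 ⟨p, rfl⟩)
  refine Module.length_eq_add_of_exact (Submodule.mapQ _ _ r hcomap.le)
    (Submodule.factor hle) ?_ (Submodule.factor_surjective hle) ?_
  · rw [← LinearMap.ker_eq_bot, Submodule.ker_mapQ, ← hcomap, Submodule.mkQ_map_self]
  · intro x
    obtain ⟨a, rfl⟩ := Submodule.mkQ_surjective _ x
    change Submodule.Quotient.mk a = 0 ↔ _
    rw [Submodule.Quotient.mk_eq_zero, mem_leftIdeal]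
    constructor
    · rintro ⟨b, rfl⟩
      exact ⟨Submodule.Quotient.mk b, rfl⟩
    · rintro ⟨y, hy⟩
      obtain ⟨b, rfl⟩ := Submodule.mkQ_surjective _ y
      have h2 : b * q - a ∈ leftIdeal (p * q) := (Submodule.Quotient.eq _).1 hy
      obtain ⟨c, hc⟩ := mem_leftIdeal.1 (hle h2)
      exact ⟨b - c, by rw [sub_mul, hc, sub_sub_cancel]⟩

/-- The number of irreducible factors of `g` is the length of the left module `R/Rg`, so it does not
depend on the factorisation. -/
theorem IsIrreducibleFactorization.length_quotient {l : List (SkewRing σ)} {g : SkewRing σ}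
    (h : g.IsIrreducibleFactorization l) :
    Module.length (SkewRing σ) (SkewRing σ ⧸ leftIdeal g) = l.length := by
  obtain ⟨hl, rfl⟩ := h
  induction l with
  | nil =>
    have : Subsingleton (SkewRing σ ⧸ leftIdeal (1 : SkewRing σ)) :=
      Submodule.Quotient.subsingleton_iff.2 (leftIdeal_eq_top_iff.2 isUnit_one)
    exact Module.length_eq_zero (M := SkewRing σ ⧸ leftIdeal (1 : SkewRing σ))
  | cons p l ih =>
    have hl' : ∀ q ∈ l, Irreducible q := fun q hq => hl q (List.mem_cons_of_mem _ hq)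
    have := isSimpleModule_quotient (hl p List.mem_cons_self)
    rw [List.prod_cons, length_quotient_mul p (List.prod_ne_zero fun h0 => (hl' 0 h0).ne_zero rfl),
      ih hl', Module.length_eq_one, List.length_cons, Nat.cast_succ, add_comm]

theorem exists_isIrreducibleFactorization {g : SkewRing σ} (hg : g ≠ 0) (hu : ¬ IsUnit g) :
    ∃ l, g.IsIrreducibleFactorization l := by
  obtain ⟨k, hk⟩ := exists_hasDegree hg
  induction k using Nat.strong_induction_on generalizing g with
  | _ k ih =>
    by_cases hirr : Irreducible g
    · exact ⟨[g], by simpa using hirr, by simp⟩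
    obtain ⟨a, b, rfl, ha, hb⟩ : ∃ a b, g = a * b ∧ ¬ IsUnit a ∧ ¬ IsUnit b := by
      simpa [irreducible_iff, hu] using hirr
    obtain ⟨i, hi⟩ := exists_hasDegree (left_ne_zero_of_mul hg)
    obtain ⟨j, hj⟩ := exists_hasDegree (right_ne_zero_of_mul hg)
    obtain rfl := hk.unique (hi.mul hj)
    have hi0 : i ≠ 0 := by rintro rfl; exact ha (hasDegree_zero_iff_isUnit.1 hi)
    have hj0 : j ≠ 0 := by rintro rfl; exact hb (hasDegree_zero_iff_isUnit.1 hj)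
    obtain ⟨l, hl, hla⟩ := ih i (by omega) (left_ne_zero_of_mul hg) ha hi
    obtain ⟨m, hm, hmb⟩ := ih j (by omega) (right_ne_zero_of_mul hg) hb hj
    refine ⟨l ++ m, fun p hp => ?_, by rw [List.prod_append, hla, hmb]⟩
    exact (List.mem_append.1 hp).elim (hl p) (hm p)

end Ideals

/-! ### The quotient `R/Rf` -/

section Quotient

variable {K L : Type*} [Field K] [Field L] [Algebra K L] {σ : L ≃ₐ[K] L}

/-- The class of `g` in `R/Rf`. -/
abbrev mk (f g : SkewRing σ) : SkewRing σ ⧸ leftIdeal f := Submodule.Quotient.mk g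

theorem smul_mk (f g r : SkewRing σ) : r • mk f g = mk f (r * g) := rfl

theorem smul_quotient_def (f : SkewRing σ) (a : L) (v : SkewRing σ ⧸ leftIdeal f) :
    a • v = (C a : SkewRing σ) • v := by
  induction v using Submodule.Quotient.induction_on with
  | _ r => rfl

theorem smul_base_quotient_def (f : SkewRing σ) (a : K) (v : SkewRing σ ⧸ leftIdeal f) :
    a • v = (C (algebraMap K L a) : SkewRing σ) • v := by
  induction v using Submodule.Quotient.induction_on with
  | _ r => rfl

instance (f : SkewRing σ) : IsScalarTower K L (SkewRing σ ⧸ leftIdeal f) where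
  smul_assoc a b v := by
    induction v using Submodule.Quotient.induction_on with
    | _ r => exact congrArg (mk f) (smul_assoc a b r)

theorem linearIndependent_mk_X_pow {f : SkewRing σ} {k : ℕ} (hf : f.HasDegree k) :
    LinearIndependent L fun i : Fin k => mk f (X ^ (i : ℕ)) := by
  rw [Fintype.linearIndependent_iff]
  intro g hg i
  set r : SkewRing σ := ∑ i : Fin k, g i • X ^ (i : ℕ) with hr
  have hcoeff (j : ℕ) : r.coeff j = ∑ i : Fin k, if (i : ℕ) = j then g i else 0 := by
    simp [hr, coeff_sum, coeff_X_pow]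
  have hmk : mk f r = 0 := by
    rw [← hg, hr]
    exact map_sum (Submodule.mkQ (leftIdeal f)) _ _
  obtain ⟨q, hq⟩ := mem_leftIdeal.1 ((Submodule.Quotient.mk_eq_zero _).1 hmk)
  have hrdeg : r ∈ degreeLT σ k := mem_degreeLT.2 fun j hj => by
    rw [hcoeff]
    exact Finset.sum_eq_zero fun i _ => if_neg (by omega)
  rw [← hq] at hrdeg
  rw [eq_zero_of_mul_mem_degreeLT hf hrdeg, zero_mul] at hq
  have := hcoeff i
  rw [← hq, coeff_zero] at this
  simpa [Fin.val_inj] using this.symm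

theorem span_mk_X_pow {f : SkewRing σ} {k : ℕ} (hf : f.HasDegree k) :
    ⊤ ≤ Submodule.span L (Set.range fun i : Fin k => mk f (X ^ (i : ℕ))) := by
  rintro v -
  obtain ⟨g, rfl⟩ := Submodule.Quotient.mk_surjective _ v
  obtain ⟨q, r, hr, rfl⟩ := exists_eq_mul_add hf g
  have h1 : mk f (q * f + r) = mk f r :=
    (Submodule.Quotient.eq _).2 (mem_leftIdeal.2 ⟨q, (add_sub_cancel_right _ _).symm⟩)
  have h2 : mk f r = ∑ i ∈ Finset.range k, r.coeff i • mk f (X ^ i) := by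
    conv_lhs => rw [eq_sum_of_mem_degreeLT hr]
    exact map_sum (Submodule.mkQ (leftIdeal f)) _ _
  change mk f (q * f + r) ∈ _
  rw [h1, h2]
  exact Submodule.sum_mem _ fun i hi => Submodule.smul_mem _ _
    (Submodule.subset_span ⟨⟨i, Finset.mem_range.1 hi⟩, rfl⟩)

/-- The classes of `1, x, …, x^{k-1}` form a basis of `R/Rf` over `L`, where `k = deg f`. -/
def powerBasis {f : SkewRing σ} {k : ℕ} (hf : f.HasDegree k) :
    Module.Basis (Fin k) L (SkewRing σ ⧸ leftIdeal f) :=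
  Module.Basis.mk (linearIndependent_mk_X_pow hf) (span_mk_X_pow hf)

theorem powerBasis_apply {f : SkewRing σ} {k : ℕ} (hf : f.HasDegree k) (i : Fin k) :
    powerBasis hf i = mk f (X ^ (i : ℕ)) :=
  Module.Basis.mk_apply _ _ i

theorem HasDegree.finrank_quotient {f : SkewRing σ} {k : ℕ} (hf : f.HasDegree k) :
    Module.finrank L (SkewRing σ ⧸ leftIdeal f) = k := by
  rw [Module.finrank_eq_card_basis (powerBasis hf), Fintype.card_fin]

theorem HasDegree.finiteDimensional_quotient {f : SkewRing σ} {k : ℕ} (hf : f.HasDegree k) :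
    FiniteDimensional L (SkewRing σ ⧸ leftIdeal f) :=
  Module.Finite.of_basis (powerBasis hf)

theorem mk_X_pow_degree {f : SkewRing σ} {h : ℕ} (hf : f.IsMonicOfDegree h) :
    mk f (X ^ h) = ∑ i : Fin h, (-f.coeff i) • mk f (X ^ (i : ℕ)) := by
  have h1 : f = ∑ i ∈ Finset.range h, f.coeff i • X ^ i + X ^ h := by
    conv_lhs => rw [eq_sum_of_mem_degreeLT hf.hasDegree.2, Finset.sum_range_succ, hf.1, one_smul]
  have h2 : Submodule.mkQ (leftIdeal f) (∑ i ∈ Finset.range h, f.coeff i • X ^ i + X ^ h) = 0 := by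
    rw [← h1]
    exact (Submodule.Quotient.mk_eq_zero _).2 (Ideal.mem_span_singleton_self f)
  rw [map_add, map_sum, Finset.sum_range] at h2
  refine (eq_neg_of_add_eq_zero_right h2).trans ?_
  rw [← Finset.sum_neg_distrib]
  exact Finset.sum_congr rfl fun i _ =>
    (neg_smul (f.coeff i) (mk f (X ^ (i : ℕ)))).symm

end Quotient

/-! ### The matrix of `φ_fⁿ` -/

section Matrix

variable {K L : Type*} [Field K] [Field L] [Algebra K L] {σ : L ≃ₐ[K] L}

/-- The product `C_f C_f^σ ⋯ C_f^{σ^{k-1}}`. -/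
def companionProd (f : SkewRing σ) (h k : ℕ) : Matrix (Fin h) (Fin h) L :=
  ((List.range k).map fun i => (companion f h).map ⇑(σ ^ i)).prod

theorem map_companionProd (f : SkewRing σ) (h k : ℕ) :
    (companionProd f h k).map σ =
      ((List.range k).map fun i => (companion f h).map ⇑(σ ^ (i + 1))).prod := by
  have key := map_list_prod (σ : L →+* L).mapMatrix
    ((List.range k).map fun i => (companion f h).map ⇑(σ ^ i))
  rw [List.map_map] at key
  refine key.trans (congrArg List.prod (List.map_congr_left fun i _ => ?_))
  ext a b
  simp [pow_succ']

theorem companionProd_succ (f : SkewRing σ) (h k : ℕ) :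
    companionProd f h (k + 1) = companion f h * (companionProd f h k).map σ := by
  rw [map_companionProd, companionProd, List.range_succ_eq_map, List.map_cons, List.prod_cons,
    List.map_map]
  congr 1

theorem companionProd_succ' (f : SkewRing σ) (h k : ℕ) :
    companionProd f h (k + 1) = companionProd f h k * (companion f h).map ⇑(σ ^ k) := by
  rw [companionProd, List.range_succ, List.map_append, List.prod_append, List.map_singleton,
    List.prod_singleton]
  rfl

theorem phi_mk (f g : SkewRing σ) : phi f (mk f g) = mk f (X * g) := rfl

theorem phi_powerBasis {f : SkewRing σ} {h : ℕ} (hf : f.IsMonicOfDegree h) (j : Fin h) :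
    phi f (powerBasis hf.hasDegree j) =
      ∑ i, companion f h i j • powerBasis hf.hasDegree i := by
  simp only [powerBasis_apply, phi_mk, ← pow_succ']
  by_cases hj : (j : ℕ) + 1 = h
  · simp only [companion, Matrix.of_apply, if_pos hj]
    rw [hj, mk_X_pow_degree hf]
  · simp only [companion, Matrix.of_apply, if_neg hj]
    rw [Finset.sum_eq_single ⟨(j : ℕ) + 1, by omega⟩]
    · simp
    · intro b _ hb
      rw [if_neg (fun h => hb (Fin.ext h)), zero_smul]
    · simp

/-- Pulling scalars through the semilinear map `φ_f` twists them by `σ`, so iterating `φ_f` produces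
the twisted product of companion matrices. -/
theorem phi_iterate_powerBasis {f : SkewRing σ} {h : ℕ} (hf : f.IsMonicOfDegree h) (k : ℕ)
    (j : Fin h) :
    (phi f)^[k] (powerBasis hf.hasDegree j) =
      ∑ i, companionProd f h k i j • powerBasis hf.hasDegree i := by
  induction k with
  | zero =>
    simp [companionProd, Matrix.one_apply]
  | succ k ih =>
    rw [Function.iterate_succ_apply', ih, map_sum]
    simp only [map_smulₛₗ, phi_powerBasis hf, Finset.smul_sum, smul_smul]
    rw [Finset.sum_comm]
    refine Finset.sum_congr rfl fun i _ => ?_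
    rw [companionProd_succ, Matrix.mul_apply, Finset.sum_smul]
    refine Finset.sum_congr rfl fun l _ => ?_
    rw [mul_comm]
    rfl

variable [FiniteDimensional K L] [IsGalois K L]

theorem toMatrix_phiPow {f : SkewRing σ} {h : ℕ} (hf : f.IsMonicOfDegree h) :
    LinearMap.toMatrix (powerBasis hf.hasDegree) (powerBasis hf.hasDegree) (phiPow f) =
      matA f h := by
  ext i j
  rw [LinearMap.toMatrix_apply]
  have : phiPow f (powerBasis hf.hasDegree j) =
      ∑ i, matA f h i j • powerBasis hf.hasDegree i := phi_iterate_powerBasis hf _ j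
  rw [this, Module.Basis.repr_sum_self]

/-- With `A_f = C_f B`, `B = C_f^σ ⋯ C_f^{σ^{n-1}}`, the relation `σⁿ = 1` gives `A_f^σ = B C_f`,
and `C_f B` and `B C_f` have the same characteristic polynomial. -/
theorem map_charpoly_matA (f : SkewRing σ) (h : ℕ) :
    (matA f h).charpoly.map (σ : L →+* L) = (matA f h).charpoly := by
  obtain ⟨n, hn⟩ := Nat.exists_eq_succ_of_ne_zero (Module.finrank_pos (R := K) (M := L)).ne'
  have hA : matA f h = companionProd f h (n + 1) := by rw [← Nat.succ_eq_add_one, ← hn]; rfl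
  have h1 : σ ^ (n + 1) = 1 := by rw [← Nat.succ_eq_add_one, ← hn, pow_finrank_eq_one]
  have hmap : (companionProd f h (n + 1)).map σ = (companionProd f h n).map σ * companion f h := by
    rw [companionProd_succ']
    refine (map_mul (σ : L →+* L).mapMatrix _ _).trans (congrArg₂ (· * ·) rfl ?_)
    ext a b
    have : σ ((σ ^ n) (companion f h a b)) = (σ ^ (n + 1)) (companion f h a b) := by
      rw [pow_succ']; rfl
    rw [h1] at this
    exact this
  rw [← Matrix.charpoly_map, hA]
  change ((companionProd f h (n + 1)).map σ).charpoly = _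
  rw [hmap, companionProd_succ, Matrix.charpoly_mul_comm]

end Matrix

/-! ### Polynomials in `xⁿ` -/

section Central

variable {K L : Type*} [Field K] [Field L] [Algebra K L] {σ : L ≃ₐ[K] L}

/-- The element `G(xⁿ)` of `L[x; σ]`, for `G ∈ L[y]` and `n = [L : K]`, with the coefficients of
`G` on the left. -/
def evalXPow (σ : L ≃ₐ[K] L) (G : Polynomial L) : SkewRing σ :=
  G.eval₂ C (X ^ Module.finrank K L)

theorem evalXPow_map (F : Polynomial K) :
    evalXPow σ (F.map (algebraMap K L)) = central σ F :=
  Polynomial.eval₂_map _ _ _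

theorem evalXPow_add (G H : Polynomial L) :
    evalXPow σ (G + H) = evalXPow σ G + evalXPow σ H :=
  Polynomial.eval₂_add _ _

theorem evalXPow_monomial (i : ℕ) (a : L) :
    evalXPow σ (Polynomial.monomial i a) = C a * X ^ (Module.finrank K L * i) := by
  rw [evalXPow, Polynomial.eval₂_monomial, pow_mul]

variable [FiniteDimensional K L]

theorem coeff_evalXPow (G : Polynomial L) (k : ℕ) :
    (evalXPow σ G).coeff k =
      if Module.finrank K L ∣ k then G.coeff (k / Module.finrank K L) else 0 := by
  have hn : 0 < Module.finrank K L := Module.finrank_pos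
  induction G using Polynomial.induction_on' with
  | add p q hp hq => rw [evalXPow_add, coeff_add, hp, hq]; split_ifs <;> simp
  | monomial i a =>
    rw [evalXPow_monomial, coeff_C_mul_X_pow, Polynomial.coeff_monomial]
    by_cases h : Module.finrank K L ∣ k
    · obtain ⟨j, rfl⟩ := h
      rw [Nat.mul_div_cancel_left _ hn]
      simp [hn.ne']
    · rw [if_neg (fun h' => h ⟨i, h'.symm⟩), if_neg h]

theorem hasDegree_evalXPow {G : Polynomial L} (hG : G ≠ 0) :
    (evalXPow σ G).HasDegree (Module.finrank K L * G.natDegree) := by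
  have hn : 0 < Module.finrank K L := Module.finrank_pos
  refine ⟨?_, mem_degreeLT.2 fun i hi => ?_⟩
  · simpa [coeff_evalXPow, Nat.mul_div_cancel_left _ hn] using hG
  · rw [coeff_evalXPow]
    split_ifs with h
    · obtain ⟨j, rfl⟩ := h
      rw [Nat.mul_div_cancel_left _ hn]
      exact Polynomial.coeff_eq_zero_of_natDegree_lt
        (Nat.lt_of_mul_lt_mul_left (Nat.lt_of_succ_le hi))
    · rfl

theorem hasDegree_central {F : Polynomial K} (hF : F.Monic) :
    (central σ F).HasDegree (Module.finrank K L * F.natDegree) := by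
  rw [← evalXPow_map, ← F.natDegree_map (algebraMap K L)]
  exact hasDegree_evalXPow (hF.map _).ne_zero

omit [FiniteDimensional K L] in
theorem commute_C_algebraMap (a : K) (r : SkewRing σ) : Commute (C (algebraMap K L a)) r := by
  ext i
  rw [coeff_C_mul, coeff_mul_C, AlgEquiv.commutes, mul_comm]

variable [IsGalois K L]

theorem commute_X_pow_finrank (r : SkewRing σ) : Commute (X ^ Module.finrank K L) r := by
  induction r using SkewRing.induction with
  | add f g hf hg => exact hf.add_right hg
  | monomial a i =>
    refine Commute.mul_right ?_ ((Commute.refl X).pow_pow _ _)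
    rw [commute_iff_eq, X_pow_mul_C, pow_finrank_eq_one]
    rfl

theorem commute_central (F : Polynomial K) (r : SkewRing σ) : Commute (central σ F) r := by
  induction F using Polynomial.induction_on' with
  | add p q hp hq =>
    rw [central, Polynomial.eval₂_add]
    exact hp.add_left hq
  | monomial i a =>
    rw [central, Polynomial.eval₂_monomial]
    exact (commute_C_algebraMap a r).mul_left ((commute_X_pow_finrank r).pow_left i)

theorem evalXPow_mul (G H : Polynomial L) :
    evalXPow σ (G * H) = evalXPow σ G * evalXPow σ H :=
  Polynomial.eval₂_mul_noncomm _ _ fun _ => (commute_X_pow_finrank _).symm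

/-- If `H ∤ G`, the nonzero remainder of `G` modulo `H` would give an element of `RH(xⁿ)` of degree
less than that of `H(xⁿ)`. -/
theorem evalXPow_mem_leftIdeal {G H : Polynomial L} (hH : H.Monic) :
    evalXPow σ G ∈ leftIdeal (evalXPow σ H) ↔ H ∣ G := by
  constructor
  · intro h
    obtain ⟨q, hq⟩ := mem_leftIdeal.1 h
    have hdiv : evalXPow σ (G %ₘ H) = (q - evalXPow σ (G /ₘ H)) * evalXPow σ H := by
      rw [sub_mul, hq, ← evalXPow_mul, eq_sub_iff_add_eq, ← evalXPow_add, mul_comm,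
        Polynomial.modByMonic_add_div]
    by_contra hdvd
    have hne : G %ₘ H ≠ 0 := fun h0 => hdvd ((Polynomial.modByMonic_eq_zero_iff_dvd hH).1 h0)
    have hH1 : H ≠ 1 := by rintro rfl; exact hdvd (one_dvd G)
    have hlt := Polynomial.natDegree_modByMonic_lt G hH hH1
    have hmem : evalXPow σ (G %ₘ H) ∈ degreeLT σ (Module.finrank K L * H.natDegree) :=
      degreeLT_mono (Nat.mul_lt_mul_of_pos_left hlt Module.finrank_pos)
        (hasDegree_evalXPow hne).2
    rw [hdiv] at hmem
    rw [eq_zero_of_mul_mem_degreeLT (hasDegree_evalXPow hH.ne_zero) hmem, zero_mul] at hdiv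
    exact (hasDegree_evalXPow (σ := σ) hne).ne_zero hdiv
  · rintro ⟨Q, rfl⟩
    exact mem_leftIdeal.2 ⟨evalXPow σ Q, by rw [← evalXPow_mul, mul_comm]⟩

end Central

/-! ### The bound and the minimal polynomials of `φ_fⁿ` -/

section Bound

variable {K L : Type*} [Field K] [Field L] [Algebra K L] [FiniteDimensional K L] [IsGalois K L]
  {σ : L ≃ₐ[K] L}

theorem phiPow_apply (f : SkewRing σ) (v : SkewRing σ ⧸ leftIdeal f) :
    phiPow f v = (X ^ Module.finrank K L : SkewRing σ) • v := by
  have (k : ℕ) : (phi f)^[k] v = (X ^ k : SkewRing σ) • v := by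
    induction k with
    | zero => simp
    | succ k ih => rw [Function.iterate_succ_apply', ih, pow_succ', mul_smul]; rfl
  exact this _

theorem phiPow_pow_apply (f : SkewRing σ) (i : ℕ) (v : SkewRing σ ⧸ leftIdeal f) :
    (phiPow f ^ i) v = ((X ^ Module.finrank K L) ^ i : SkewRing σ) • v := by
  induction i with
  | zero => simp
  | succ i ih => rw [pow_succ', Module.End.mul_apply, ih, phiPow_apply, pow_succ', mul_smul]

theorem aeval_phiPow_apply (f : SkewRing σ) (G : Polynomial L) (v : SkewRing σ ⧸ leftIdeal f) :
    Polynomial.aeval (phiPow f) G v = evalXPow σ G • v := by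
  induction G using Polynomial.induction_on' with
  | add p q hp hq => rw [map_add, LinearMap.add_apply, hp, hq, evalXPow_add, add_smul]
  | monomial i a =>
    rw [Polynomial.aeval_monomial, evalXPow_monomial, pow_mul, mul_smul, ← phiPow_pow_apply,
      ← smul_quotient_def]
    rfl

theorem aeval_phiPowBase_apply (f : SkewRing σ) (G : Polynomial K)
    (v : SkewRing σ ⧸ leftIdeal f) :
    Polynomial.aeval (phiPowBase f) G v = central σ G • v := by
  induction G using Polynomial.induction_on' with
  | add p q hp hq =>
    rw [map_add, LinearMap.add_apply, hp, hq, central, central, central, Polynomial.eval₂_add,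
      add_smul]
  | monomial i a =>
    have hpow (w : SkewRing σ ⧸ leftIdeal f) : (phiPowBase f ^ i) w = (phiPow f ^ i) w := by
      induction i generalizing w with
      | zero => rfl
      | succ i ih => rw [pow_succ, pow_succ]; exact ih _
    rw [Polynomial.aeval_monomial, central, Polynomial.eval₂_monomial, mul_smul,
      ← phiPow_pow_apply, ← hpow]
    exact smul_base_quotient_def f a _

/-- The annihilator of `R/Rf` is `RF(xⁿ)`. -/
theorem smul_quotient_eq_zero_iff {f : SkewRing σ} {F : Polynomial K}
    (hbound : f.IsBound (central σ F)) (g : SkewRing σ) :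
    (∀ v : SkewRing σ ⧸ leftIdeal f, g • v = 0) ↔ g ∈ leftIdeal (central σ F) := by
  obtain ⟨-, hle, hmax⟩ := hbound
  constructor
  · intro hg
    refine hmax (Module.annihilator (SkewRing σ) (SkewRing σ ⧸ leftIdeal f)) inferInstance
      (fun r hr => ?_) (Module.mem_annihilator.2 hg)
    have := Module.mem_annihilator.1 hr (mk f 1)
    rwa [smul_mk, mul_one, Submodule.Quotient.mk_eq_zero] at this
  · intro hg v
    obtain ⟨r, rfl⟩ := Submodule.Quotient.mk_surjective _ v
    obtain ⟨q, rfl⟩ := mem_leftIdeal.1 hg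
    change mk f (q * central σ F * r) = 0
    rw [Submodule.Quotient.mk_eq_zero, mul_assoc, (commute_central F r).eq, ← mul_assoc]
    exact Ideal.mul_mem_left _ _ (hle (Ideal.mem_span_singleton_self _))

theorem minpoly_phiPow {f : SkewRing σ} {F : Polynomial K} (hF : F.Monic)
    (hbound : f.IsBound (central σ F)) :
    minpoly L (phiPow f) = F.map (algebraMap K L) := by
  have hdvd (G : Polynomial L) :
      Polynomial.aeval (phiPow f) G = 0 ↔ F.map (algebraMap K L) ∣ G := by
    rw [← evalXPow_mem_leftIdeal (σ := σ) (hF.map _), evalXPow_map,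
      ← smul_quotient_eq_zero_iff hbound, LinearMap.ext_iff]
    simp only [aeval_phiPow_apply, LinearMap.zero_apply]
  have h0 := (hdvd _).2 dvd_rfl
  exact Polynomial.eq_of_monic_of_associated (minpoly.monic ⟨_, hF.map _, h0⟩) (hF.map _)
    (associated_of_dvd_dvd (minpoly.dvd _ _ h0) ((hdvd _).1 (minpoly.aeval _ _)))

theorem aeval_phiPowBase_eq_zero_iff {f : SkewRing σ} {F : Polynomial K} (hF : F.Monic)
    (hbound : f.IsBound (central σ F)) (G : Polynomial K) :
    Polynomial.aeval (phiPowBase f) G = 0 ↔ F ∣ G := by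
  rw [← Polynomial.map_dvd_map' (algebraMap K L), ← evalXPow_mem_leftIdeal (σ := σ) (hF.map _),
    evalXPow_map, evalXPow_map, ← smul_quotient_eq_zero_iff hbound, LinearMap.ext_iff]
  simp only [aeval_phiPowBase_apply, LinearMap.zero_apply]

theorem isIntegral_phiPowBase {f : SkewRing σ} {F : Polynomial K} (hF : F.Monic)
    (hbound : f.IsBound (central σ F)) : IsIntegral K (phiPowBase f) :=
  ⟨F, hF, (aeval_phiPowBase_eq_zero_iff hF hbound F).2 dvd_rfl⟩

theorem minpoly_phiPowBase {f : SkewRing σ} {F : Polynomial K} (hF : F.Monic)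
    (hbound : f.IsBound (central σ F)) : minpoly K (phiPowBase f) = F := by
  have hdvd := aeval_phiPowBase_eq_zero_iff hF hbound
  exact Polynomial.eq_of_monic_of_associated (minpoly.monic (isIntegral_phiPowBase hF hbound)) hF
    (associated_of_dvd_dvd (minpoly.dvd _ _ ((hdvd _).2 dvd_rfl))
      ((hdvd _).1 (minpoly.aeval _ _)))

end Bound

end SkewRing

/-! ### The characteristic polynomial divides a power of any annihilating polynomial -/

section CharpolyDvd

open Polynomial in
/-- If `p(A) = 0` then `p(y) · 1 = p(y · 1) - p(A)` is a multiple of `y · 1 - A`; the claim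
follows by taking determinants. -/
theorem Matrix.charpoly_dvd_pow_of_aeval_eq_zero {R ι : Type*} [CommRing R] [Fintype ι]
    [DecidableEq ι] (A : Matrix ι ι R) {p : R[X]} (hp : aeval A p = 0) :
    A.charpoly ∣ p ^ Fintype.card ι := by
  have key (q : R[X]) : ∃ B, scalar ι q - (aeval A q).map C = charmatrix A * B := by
    induction q using Polynomial.induction_on' with
    | add q r hq hr =>
      obtain ⟨B, hB⟩ := hq
      obtain ⟨B', hB'⟩ := hr
      refine ⟨B + B', ?_⟩
      rw [mul_add, ← hB, ← hB', map_add, map_add, Matrix.map_add _ (by simp)]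
      abel
    | monomial i a =>
      have hcomm : Commute (scalar ι (X : R[X])) (A.map C) :=
        scalar_commute _ (fun _ => Commute.all _ _) _
      have hmap : (A ^ i).map C = (A.map C : Matrix ι ι R[X]) ^ i :=
        map_pow (C : R →+* R[X]).mapMatrix A i
      refine ⟨(∑ j ∈ Finset.range i, scalar ι X ^ j * A.map C ^ (i - 1 - j)) * scalar ι (C a), ?_⟩
      have : charmatrix A = scalar ι X - A.map C := rfl
      rw [this, ← mul_assoc, hcomm.mul_geom_sum₂, ← hmap, ← map_pow, sub_mul, ← map_mul,
        aeval_monomial, ← C_mul_X_pow_eq_monomial, mul_comm (X ^ i)]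
      congr 1
      ext j k
      simp [Matrix.algebraMap_matrix_apply, Matrix.mul_apply, Matrix.diagonal, mul_comm]
  obtain ⟨B, hB⟩ := key p
  refine ⟨B.det, ?_⟩
  rw [hp, Matrix.map_zero _ (by simp), sub_zero] at hB
  rw [Matrix.charpoly, ← Matrix.det_mul, ← hB]
  simp

end CharpolyDvd

/-! ### Submodules of powers of a simple module -/

section SimpleModules

variable {R M N : Type*} [Ring R] [AddCommGroup M] [Module R M] [AddCommGroup N] [Module R N]

/-- A simple submodule of `M^ι` projects isomorphically to some coordinate. -/
theorem isIsotypicOfType_pi [IsSimpleModule R M] (ι : Type*) :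
    IsIsotypicOfType R (ι → M) M := by
  intro S _
  obtain ⟨v, hv, hv0⟩ := Submodule.exists_mem_ne_zero_of_ne_bot (IsSimpleModule.nontrivial R S |>
    (Submodule.nontrivial_iff_ne_bot).1)
  obtain ⟨i, hi⟩ := Function.ne_iff.1 hv0
  let p : S →ₗ[R] M := LinearMap.proj i ∘ₗ S.subtype
  have hp : p ≠ 0 := fun h => hi (LinearMap.congr_fun h ⟨v, hv⟩)
  exact ⟨LinearEquiv.ofBijective p (LinearMap.bijective_of_ne_zero hp)⟩

theorem exists_linearEquiv_fun_of_injective [IsSimpleModule R M] [Module.Finite R N] {ι : Type*}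
    [Finite ι] (j : N →ₗ[R] ι → M) (hj : Function.Injective j) :
    ∃ m : ℕ, Nonempty (N ≃ₗ[R] Fin m → M) := by
  have := IsSemisimpleModule.of_injective j hj
  exact ((isIsotypicOfType_pi ι).of_injective j hj).linearEquiv_fun

end SimpleModules

/-! ### Finite-dimensional division algebras -/

section DivisionAlgebras

variable {K D : Type*} [Field K]

/-- `D` is a vector space over the field `K[x]`. -/
theorem minpoly.natDegree_dvd_finrank [Ring D] [IsDomain D] [Algebra K D] [FiniteDimensional K D]
    (x : D) : (minpoly K x).natDegree ∣ Module.finrank K D := by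
  have hx : IsIntegral K x := Algebra.IsIntegral.isIntegral x
  have : Fact (Irreducible (minpoly K x)) := ⟨minpoly.irreducible hx⟩
  let j : AdjoinRoot (minpoly K x) →ₐ[K] D :=
    Ideal.Quotient.liftₐ _ (Polynomial.aeval x) fun a ha => by
      obtain ⟨b, rfl⟩ := Ideal.mem_span_singleton.1 ha
      rw [map_mul, minpoly.aeval, zero_mul]
  let : Module (AdjoinRoot (minpoly K x)) D := Module.compHom D j.toRingHom
  have : IsScalarTower K (AdjoinRoot (minpoly K x)) D := ⟨fun a b c => by
    change j (a • b) * c = a • (j b * c)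
    rw [map_smul, smul_mul_assoc]⟩
  have h1 := Module.finrank_mul_finrank K (AdjoinRoot (minpoly K x)) D
  have h2 : Module.finrank K (AdjoinRoot (minpoly K x)) = (minpoly K x).natDegree :=
    finrank_quotient_span_eq_natDegree
  exact ⟨_, (h2 ▸ h1).symm⟩

theorem minpoly.finrank_le_natDegree_of_surjective [Ring D] [Algebra K D] [FiniteDimensional K D]
    (x : D) (hsurj : ∀ y : D, ∃ p : Polynomial K, Polynomial.aeval x p = y) :
    Module.finrank K D ≤ (minpoly K x).natDegree := by
  let j : AdjoinRoot (minpoly K x) →ₐ[K] D :=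
    Ideal.Quotient.liftₐ _ (Polynomial.aeval x) fun a ha => by
      obtain ⟨b, rfl⟩ := Ideal.mem_span_singleton.1 ha
      rw [map_mul, minpoly.aeval, zero_mul]
  have hx : IsIntegral K x := Algebra.IsIntegral.isIntegral x
  have : FiniteDimensional K (AdjoinRoot (minpoly K x)) :=
    (AdjoinRoot.powerBasis (minpoly.ne_zero hx)).finite
  have h2 : Module.finrank K (AdjoinRoot (minpoly K x)) = (minpoly K x).natDegree :=
    finrank_quotient_span_eq_natDegree
  rw [← h2]
  refine LinearMap.finrank_le_finrank_of_surjective (f := j.toLinearMap) fun y => ?_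
  obtain ⟨p, rfl⟩ := hsurj y
  exact ⟨AdjoinRoot.mk _ p, rfl⟩

/-- A finite division algebra `D` is commutative by Wedderburn's little theorem, so its elements are
`D`-linear endomorphisms of any `D`-space `M`; a space of `D`-linear endomorphisms of the same
dimension as `End_D(M)` therefore contains them. -/
theorem exists_mem_forall_eq_smul_of_finite [Finite K] [DivisionRing D] [Algebra K D]
    [FiniteDimensional K D] {M : Type*} [AddCommGroup M] [Module D M] [Module K M]
    [IsScalarTower K D M] [FiniteDimensional K M] (W : Submodule K (Module.End K M))
    (hW : ∀ w ∈ W, ∀ (δ : D) (v : M), w (δ • v) = δ • w v)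
    (hdim : Module.finrank K W * Module.finrank K D = Module.finrank K M ^ 2) (δ : D) :
    ∃ w ∈ W, ∀ v, w v = δ • v := by
  have : Finite D := Module.finite_of_finite K
  let : Field D := littleWedderburn D
  have : Module.Finite D M := Module.Finite.of_restrictScalars_finite K D M
  let T : Module.End D M →ₗ[K] Module.End K M := LinearMap.restrictScalarsₗ K D M M K
  have hT : Function.Injective T := LinearMap.restrictScalars_injective K
  have h1 := Module.finrank_mul_finrank K D M
  have h2 : Module.finrank K (LinearMap.range T) =
      Module.finrank K D * (Module.finrank D M * Module.finrank D M) := by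
    rw [LinearMap.finrank_range_of_inj hT, ← Module.finrank_mul_finrank K D,
      Module.finrank_linearMap]
  have hle : W ≤ LinearMap.range T := fun w hw =>
    ⟨{ toFun := w, map_add' := map_add w, map_smul' := hW w hw }, rfl⟩
  have heq : W = LinearMap.range T := by
    refine Submodule.eq_of_le_of_finrank_eq hle ?_
    have hpos : 0 < Module.finrank K D := Module.finrank_pos
    refine Nat.eq_of_mul_eq_mul_right hpos ?_
    rw [hdim, h2, ← h1]
    ring
  refine ⟨T (δ • LinearMap.id), heq ▸ ⟨_, rfl⟩, fun v => rfl⟩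

end DivisionAlgebras

namespace SkewRing

/-! ### The division algebra `End_R(R/Rf)` -/

section Schur

variable {K L : Type*} [Field K] [Field L] [Algebra K L] {σ : L ≃ₐ[K] L}

instance instSMulCommClassQuotient (f : SkewRing σ) :
    SMulCommClass (SkewRing σ) K (SkewRing σ ⧸ leftIdeal f) where
  smul_comm r a v := by
    rw [smul_base_quotient_def, smul_base_quotient_def, smul_smul, smul_smul,
      (commute_C_algebraMap a r).eq]

instance instSMulCommClassQuotient' (f : SkewRing σ) :
    SMulCommClass K (SkewRing σ) (SkewRing σ ⧸ leftIdeal f) :=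
  SMulCommClass.symm _ _ _

variable [FiniteDimensional K L]

theorem HasDegree.finiteDimensional_base {f : SkewRing σ} {k : ℕ} (hf : f.HasDegree k) :
    FiniteDimensional K (SkewRing σ ⧸ leftIdeal f) :=
  have := hf.finiteDimensional_quotient
  Module.Finite.trans L _

omit [FiniteDimensional K L] in
theorem HasDegree.finrank_base {f : SkewRing σ} {k : ℕ} (hf : f.HasDegree k) :
    Module.finrank K (SkewRing σ ⧸ leftIdeal f) = Module.finrank K L * k := by
  rw [← Module.finrank_mul_finrank K L, hf.finrank_quotient]

/-- An `R`-linear endomorphism of `R/Rf`, regarded as a `K`-linear one. -/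
def endToBase (f : SkewRing σ) :
    Module.End (SkewRing σ) (SkewRing σ ⧸ leftIdeal f) →ₐ[K]
      Module.End K (SkewRing σ ⧸ leftIdeal f) where
  toFun δ := δ.restrictScalars K
  map_one' := rfl
  map_mul' _ _ := rfl
  map_zero' := rfl
  map_add' _ _ := rfl
  commutes' _ := rfl

omit [FiniteDimensional K L] in
theorem endToBase_injective (f : SkewRing σ) : Function.Injective (endToBase f) :=
  LinearMap.restrictScalars_injective K

theorem HasDegree.finiteDimensional_end {f : SkewRing σ} {k : ℕ} (hf : f.HasDegree k) :
    FiniteDimensional K (Module.End (SkewRing σ) (SkewRing σ ⧸ leftIdeal f)) :=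
  have := hf.finiteDimensional_base
  Module.Finite.of_injective (endToBase f).toLinearMap (endToBase_injective f)

variable [IsGalois K L]

/-- The map `φ_fⁿ`, which is multiplication by the central element `xⁿ`, as an `R`-linear
endomorphism of `R/Rf`. -/
def phiEnd (f : SkewRing σ) : Module.End (SkewRing σ) (SkewRing σ ⧸ leftIdeal f) where
  toFun := phiPow f
  map_add' := map_add _
  map_smul' r v := by
    simp only [phiPow_apply, smul_smul, (commute_X_pow_finrank r).eq, RingHom.id_apply]

theorem endToBase_phiEnd (f : SkewRing σ) : endToBase f (phiEnd f) = phiPowBase f := rfl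

theorem aeval_phiEnd_apply (f : SkewRing σ) (G : Polynomial K) (v : SkewRing σ ⧸ leftIdeal f) :
    Polynomial.aeval (phiEnd f) G v = central σ G • v := by
  rw [← aeval_phiPowBase_apply, ← endToBase_phiEnd, Polynomial.aeval_algHom_apply]
  rfl

theorem minpoly_phiEnd {f : SkewRing σ} {F : Polynomial K} (hF : F.Monic)
    (hbound : f.IsBound (central σ F)) : minpoly K (phiEnd f) = F := by
  rw [← minpoly_phiPowBase hF hbound, ← endToBase_phiEnd,
    minpoly.algHom_eq _ (endToBase_injective f)]

omit [FiniteDimensional K L] [IsGalois K L] in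
theorem isDomain_end {f : SkewRing σ} (hirr : Irreducible f) :
    IsDomain (Module.End (SkewRing σ) (SkewRing σ ⧸ leftIdeal f)) := by
  classical
  have := isSimpleModule_quotient hirr
  let : DivisionRing (Module.End (SkewRing σ) (SkewRing σ ⧸ leftIdeal f)) := inferInstance
  exact DivisionRing.isDomain

/-- `F` is the minimal polynomial of an element of the division algebra `End_R(R/Rf)`. -/
theorem irreducible_of_isBound {f : SkewRing σ} {F : Polynomial K} {h : ℕ} (hf : f.HasDegree h)
    (hirr : Irreducible f) (hF : F.Monic) (hbound : f.IsBound (central σ F)) :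
    Irreducible F := by
  have := isDomain_end hirr
  have := hf.finiteDimensional_end
  rw [← minpoly_phiEnd hF hbound]
  exact minpoly.irreducible (Algebra.IsIntegral.isIntegral _)

theorem mem_range_algebraMap_of_apply_eq (hσ : ∀ τ : L ≃ₐ[K] L, τ ∈ Subgroup.zpowers σ) {x : L}
    (hx : σ x = x) : x ∈ Set.range (algebraMap K L) := by
  rw [IsGalois.mem_range_algebraMap_iff_fixed]
  intro τ
  have : σ ∈ MulAction.stabilizer (L ≃ₐ[K] L) x := hx
  exact (Subgroup.zpowers_le.2 this) (hσ τ)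

/-- The characteristic polynomial of `A_f` has coefficients in `K` and divides a power of the
irreducible `F`. -/
theorem exists_charpoly_matA_eq_pow (hσ : ∀ τ : L ≃ₐ[K] L, τ ∈ Subgroup.zpowers σ)
    {f : SkewRing σ} {F : Polynomial K} {h : ℕ} (hf : f.IsMonicOfDegree h)
    (hirr : Irreducible f) (hF : F.Monic) (hbound : f.IsBound (central σ F)) :
    ∃ j, (matA f h).charpoly = F.map (algebraMap K L) ^ j := by
  obtain ⟨P, hP⟩ : ∃ P : Polynomial K, P.map (algebraMap K L) = (matA f h).charpoly := by
    rw [← Polynomial.mem_lifts, Polynomial.lifts_iff_coeff_lifts]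
    intro i
    apply mem_range_algebraMap_of_apply_eq hσ
    conv_rhs => rw [← map_charpoly_matA f h, Polynomial.coeff_map]
    rfl
  have hPm : P.Monic := Polynomial.monic_of_injective (algebraMap K L).injective
    (hP ▸ Matrix.charpoly_monic _)
  have hA : Polynomial.aeval (matA f h) (F.map (algebraMap K L)) = 0 := by
    rw [← minpoly_phiPow hF hbound, ← toMatrix_phiPow hf]
    change Polynomial.aeval (LinearMap.toMatrixAlgEquiv _ (phiPow f)) _ = 0
    rw [Polynomial.aeval_algHom_apply, minpoly.aeval, map_zero]
  have hdvd : P ∣ F ^ h := by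
    rw [← Polynomial.map_dvd_map' (algebraMap K L), hP, Polynomial.map_pow]
    simpa using Matrix.charpoly_dvd_pow_of_aeval_eq_zero _ hA
  have hprime := (irreducible_of_isBound hf.hasDegree hirr hF hbound).prime
  obtain ⟨j, -, hj⟩ := (dvd_prime_pow hprime h).1 hdvd
  refine ⟨j, ?_⟩
  rw [← hP, Polynomial.eq_of_monic_of_associated hPm (hF.pow j) hj, Polynomial.map_pow]

end Schur

/-! ### The decomposition of `R/RF(xⁿ)` -/

section Multiplicity

variable {K L : Type*} [Field K] [Field L] [Algebra K L] [FiniteDimensional K L] [IsGalois K L]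
  {σ : L ≃ₐ[K] L}

/-- `R/RF(xⁿ) → (R/Rf)ᵏ`, `r ↦ (r b₁, …, r b_k)`, for a `K`-basis `b` of `R/Rf`. Only the multiples
of `F(xⁿ)` kill all of `R/Rf`, so this is injective. -/
def basisEmbedding {f : SkewRing σ} {F : Polynomial K} (hbound : f.IsBound (central σ F))
    {ι : Type*} (b : Module.Basis ι K (SkewRing σ ⧸ leftIdeal f)) :
    (SkewRing σ ⧸ leftIdeal (central σ F)) →ₗ[SkewRing σ] (ι → SkewRing σ ⧸ leftIdeal f) :=
  Submodule.liftQ _ (LinearMap.pi fun i => LinearMap.toSpanSingleton _ _ (b i)) fun r hr =>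
    funext fun i => (smul_quotient_eq_zero_iff hbound r).2 hr (b i)

theorem basisEmbedding_injective {f : SkewRing σ} {F : Polynomial K}
    (hbound : f.IsBound (central σ F)) {ι : Type*}
    (b : Module.Basis ι K (SkewRing σ ⧸ leftIdeal f)) :
    Function.Injective (basisEmbedding hbound b) := by
  rw [injective_iff_map_eq_zero]
  intro v hv
  obtain ⟨r, rfl⟩ := Submodule.Quotient.mk_surjective _ v
  rw [Submodule.Quotient.mk_eq_zero, ← smul_quotient_eq_zero_iff hbound]
  have key : Module.toModuleEnd K (S := SkewRing σ) (SkewRing σ ⧸ leftIdeal f) r = 0 :=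
    b.ext fun i => congrFun hv i
  exact LinearMap.congr_fun key

theorem exists_linearEquiv_fun {f : SkewRing σ} {F : Polynomial K} {h : ℕ} (hf : f.HasDegree h)
    (hirr : Irreducible f) (hbound : f.IsBound (central σ F)) :
    ∃ m : ℕ, Nonempty ((SkewRing σ ⧸ leftIdeal (central σ F)) ≃ₗ[SkewRing σ]
      (Fin m → SkewRing σ ⧸ leftIdeal f)) := by
  have := isSimpleModule_quotient hirr
  have := hf.finiteDimensional_base
  exact exists_linearEquiv_fun_of_injective _
    (basisEmbedding_injective hbound (Module.finBasis K _))

/-- Evaluation at the class of `1` identifies `Hom_R(R/RF(xⁿ), R/Rf)` with `R/Rf`, because `F(xⁿ)`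
kills `R/Rf`. -/
theorem finrank_hom {f : SkewRing σ} {F : Polynomial K} (hbound : f.IsBound (central σ F)) :
    Module.finrank K ((SkewRing σ ⧸ leftIdeal (central σ F)) →ₗ[SkewRing σ]
      (SkewRing σ ⧸ leftIdeal f)) = Module.finrank K (SkewRing σ ⧸ leftIdeal f) := by
  refine LinearEquiv.finrank_eq (LinearEquiv.ofBijective
    { toFun := fun u => u (mk _ 1), map_add' := fun _ _ => rfl, map_smul' := fun _ _ => rfl }
    ⟨fun u v huv => ?_, fun w => ?_⟩)
  · refine LinearMap.ext fun x => ?_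
    obtain ⟨r, rfl⟩ := Submodule.Quotient.mk_surjective _ x
    have hr : mk (central σ F) r = r • mk (central σ F) 1 := by rw [smul_mk, mul_one]
    change u (mk _ r) = v (mk _ r)
    rw [hr, map_smul, map_smul]
    exact congrArg _ huv
  · refine ⟨Submodule.liftQ _ (LinearMap.toSpanSingleton _ _ w) fun r hr =>
      (smul_quotient_eq_zero_iff hbound r).2 hr w, ?_⟩
    exact one_smul (SkewRing σ) w

/-- `R/Rf ≅ Hom_R(R/RF(xⁿ), R/Rf) ≅ Hom_R((R/Rf)^m, R/Rf) ≅ End_R(R/Rf)^m`. -/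
theorem finrank_eq_mul_finrank_end {f : SkewRing σ} {F : Polynomial K} {h m : ℕ}
    (hf : f.HasDegree h) (hbound : f.IsBound (central σ F))
    (e : (SkewRing σ ⧸ leftIdeal (central σ F)) ≃ₗ[SkewRing σ]
      (Fin m → SkewRing σ ⧸ leftIdeal f)) :
    Module.finrank K (SkewRing σ ⧸ leftIdeal f) =
      m * Module.finrank K (Module.End (SkewRing σ) (SkewRing σ ⧸ leftIdeal f)) := by
  have := hf.finiteDimensional_end
  rw [← finrank_hom hbound, (LinearEquiv.congrLeft (SkewRing σ ⧸ leftIdeal f) K e).finrank_eq,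
    ← (LinearMap.lsum (SkewRing σ) (fun _ : Fin m => SkewRing σ ⧸ leftIdeal f) K).finrank_eq,
    Module.finrank_pi_fintype]
  simp

omit [IsGalois K L] in
theorem finrank_mul_natDegree {f : SkewRing σ} {F : Polynomial K} {h m : ℕ}
    (hf : f.HasDegree h) (hF : F.Monic)
    (e : (SkewRing σ ⧸ leftIdeal (central σ F)) ≃ₗ[SkewRing σ]
      (Fin m → SkewRing σ ⧸ leftIdeal f)) :
    Module.finrank K L * F.natDegree = m * h := by
  have := hf.finiteDimensional_quotient
  rw [← (hasDegree_central (σ := σ) hF).finrank_quotient,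
    (e.restrictScalars L).finrank_eq, Module.finrank_pi_fintype]
  simp [hf.finrank_quotient]

omit [FiniteDimensional K L] [IsGalois K L] in
theorem length_quotient_central {f : SkewRing σ} {F : Polynomial K} {m : ℕ}
    (hirr : Irreducible f)
    (e : (SkewRing σ ⧸ leftIdeal (central σ F)) ≃ₗ[SkewRing σ]
      (Fin m → SkewRing σ ⧸ leftIdeal f)) :
    Module.length (SkewRing σ) (SkewRing σ ⧸ leftIdeal (central σ F)) = m := by
  have := isSimpleModule_quotient hirr
  rw [e.length_eq, Module.length_pi_of_fintype]
  simp

end Multiplicity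

/-! ### Finite base fields -/

section FiniteBase

variable {K L : Type*} [Field K] [Field L] [Algebra K L] [FiniteDimensional K L] [IsGalois K L]
  {σ : L ≃ₐ[K] L}

/-- The centre of `R/RF(xⁿ)` is the image of `K[xⁿ]`: commutators of `r` with constants and with
`x` have degree less than that of `F(xⁿ)`, so they vanish, which forces `r ∈ K[xⁿ]`. -/
theorem exists_eq_central_of_commutator_mem
    (hσ : ∀ τ : L ≃ₐ[K] L, τ ∈ Subgroup.zpowers σ) {F : Polynomial K} (hF : F.Monic)
    {r : SkewRing σ} (hr : r ∈ degreeLT σ (Module.finrank K L * F.natDegree))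
    (hcomm : ∀ s, r * s - s * r ∈ leftIdeal (central σ F)) :
    ∃ G : Polynomial K, r = central σ G := by
  set n := Module.finrank K L with hn
  have hnpos : 0 < n := Module.finrank_pos
  have horder : orderOf σ = n := by
    rw [orderOf_eq_card_of_forall_mem_zpowers hσ, IsGalois.card_aut_eq_finrank]
  have hvanish (t : SkewRing σ) (ht : t ∈ leftIdeal (central σ F))
      (htdeg : t ∈ degreeLT σ (n * F.natDegree)) : t = 0 := by
    obtain ⟨q, rfl⟩ := mem_leftIdeal.1 ht
    rw [eq_zero_of_mul_mem_degreeLT (hasDegree_central hF) htdeg, zero_mul]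
  -- commuting with the constants kills the coefficients of `xⁱ` unless `σⁱ = 1`
  have hsupp (i : ℕ) (hi : ¬ n ∣ i) : r.coeff i = 0 := by
    have hne : σ ^ i ≠ 1 := fun h => hi (horder ▸ orderOf_dvd_of_pow_eq_one h)
    obtain ⟨a, ha⟩ : ∃ a, (σ ^ i) a ≠ a := by
      by_contra! hall
      exact hne (AlgEquiv.ext hall)
    have h0 := hvanish _ (hcomm (C a)) (mem_degreeLT.2 fun j hj => by
      rw [coeff_sub, coeff_mul_C, coeff_C_mul, mem_degreeLT.1 hr j hj, zero_mul, mul_zero,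
        sub_zero])
    have h1 : (r * C a - C a * r).coeff i = 0 := by rw [h0, coeff_zero]
    rw [coeff_sub, coeff_mul_C, coeff_C_mul, mul_comm a, ← mul_sub] at h1
    exact (mul_eq_zero.1 h1).resolve_right (sub_ne_zero.2 ha)
  -- commuting with `x` puts the coefficients into the fixed field of `σ`
  have hfixed (i : ℕ) : σ (r.coeff i) = r.coeff i := by
    rcases eq_or_ne n 1 with h1 | h1
    · have : σ = 1 := by rwa [← orderOf_eq_one_iff, horder]
      rw [this]; rfl
    have h0 := hvanish _ (hcomm X) (mem_degreeLT.2 fun j hj => by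
      rcases j with _ | j
      · have hz : n * F.natDegree = 0 := by omega
        rw [hz, mem_degreeLT_zero] at hr
        simp [hr]
      · rw [coeff_sub, coeff_mul_X, coeff_X_mul]
        suffices r.coeff j = 0 by rw [this, map_zero, sub_zero]
        rcases hj.eq_or_lt with hj | hj
        -- `r * X` can have degree `n · deg F`, but `n` does not divide `n · deg F - 1`
        · refine hsupp j fun hdvd => h1 ?_
          have : n ∣ j + 1 := hj ▸ dvd_mul_right n _
          exact Nat.dvd_one.1 ((Nat.dvd_add_right hdvd).1 this)
        · exact mem_degreeLT.1 hr j (by omega))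
    have h2 : (r * X - X * r).coeff (i + 1) = 0 := by rw [h0, coeff_zero]
    rw [coeff_sub, coeff_mul_X, coeff_X_mul] at h2
    exact (sub_eq_zero.1 h2).symm
  choose g hg using fun i => mem_range_algebraMap_of_apply_eq hσ (hfixed i)
  refine ⟨∑ i ∈ Finset.range F.natDegree, Polynomial.monomial i (g (n * i)), ext fun k => ?_⟩
  rw [← evalXPow_map, coeff_evalXPow, ← hn]
  split_ifs with h
  · obtain ⟨j, rfl⟩ := h
    rw [Nat.mul_div_cancel_left _ hnpos, Polynomial.coeff_map, Polynomial.finsetSum_coeff]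
    simp only [Polynomial.coeff_monomial, Finset.sum_ite_eq', Finset.mem_range]
    split_ifs with hj
    · exact (hg _).symm
    · rw [map_zero]
      exact mem_degreeLT.1 hr _ (Nat.mul_le_mul_left n (not_lt.1 hj))
  · exact hsupp k h

/-- Over a finite field every `R`-endomorphism of `R/Rf` is multiplication by some `r ∈ R`, by
a dimension count, and `r` is central modulo `F(xⁿ)`. -/
theorem exists_aeval_phiEnd_eq_of_finite [Finite K]
    (hσ : ∀ τ : L ≃ₐ[K] L, τ ∈ Subgroup.zpowers σ) {f : SkewRing σ} {F : Polynomial K} {h m : ℕ}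
    (hf : f.HasDegree h) (hirr : Irreducible f) (hF : F.Monic)
    (hbound : f.IsBound (central σ F))
    (e : (SkewRing σ ⧸ leftIdeal (central σ F)) ≃ₗ[SkewRing σ]
      (Fin m → SkewRing σ ⧸ leftIdeal f))
    (δ : Module.End (SkewRing σ) (SkewRing σ ⧸ leftIdeal f)) :
    ∃ G : Polynomial K, Polynomial.aeval (phiEnd f) G = δ := by
  classical
  have := isSimpleModule_quotient hirr
  have := hf.finiteDimensional_base
  have := hf.finiteDimensional_end
  let b := Module.finBasis K (SkewRing σ ⧸ leftIdeal f)
  -- the action of `R/RF(xⁿ)` on `R/Rf`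
  let T : (SkewRing σ ⧸ leftIdeal (central σ F)) →ₗ[K] Module.End K (SkewRing σ ⧸ leftIdeal f) :=
    (b.constr K).toLinearMap ∘ₗ (basisEmbedding hbound b).restrictScalars K
  have hTinj : Function.Injective T :=
    (b.constr K).injective.comp (basisEmbedding_injective hbound b)
  have hT (r : SkewRing σ) (v) : T (mk _ r) v = r • v := by
    have : T (mk _ r) = Module.toModuleEnd K (S := SkewRing σ) (SkewRing σ ⧸ leftIdeal f) r :=
      b.ext fun i => b.constr_basis K _ i
    rw [this]
    rfl
  have hdim : Module.finrank K (LinearMap.range T) *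
      Module.finrank K (Module.End (SkewRing σ) (SkewRing σ ⧸ leftIdeal f)) =
      Module.finrank K (SkewRing σ ⧸ leftIdeal f) ^ 2 := by
    have h1 := finrank_eq_mul_finrank_end hf hbound e
    have h2 := finrank_mul_natDegree hf hF e
    rw [hf.finrank_base] at h1
    rw [LinearMap.finrank_range_of_inj hTinj, (hasDegree_central hF).finrank_base, h2,
      hf.finrank_base, sq]
    nth_rewrite 2 [h1]
    ring
  obtain ⟨w, ⟨x, rfl⟩, hw⟩ := exists_mem_forall_eq_smul_of_finite (LinearMap.range T)
    (by
      rintro _ ⟨x, rfl⟩ ε v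
      obtain ⟨r, rfl⟩ := Submodule.Quotient.mk_surjective _ x
      rw [hT, hT]
      exact (map_smul ε r v).symm) hdim δ
  obtain ⟨s, rfl⟩ := Submodule.Quotient.mk_surjective _ x
  obtain ⟨q, r, hr, rfl⟩ := exists_eq_mul_add (hasDegree_central (σ := σ) hF) s
  have hδ (v) : δ v = r • v := by
    rw [← Module.End.smul_def, ← hw, hT, add_smul,
      (smul_quotient_eq_zero_iff hbound _).2 (mem_leftIdeal.2 ⟨q, rfl⟩), zero_add]
  obtain ⟨G, rfl⟩ := exists_eq_central_of_commutator_mem hσ hF hr fun s => by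
    rw [← smul_quotient_eq_zero_iff hbound]
    intro v
    rw [sub_smul, mul_smul, mul_smul, ← hδ, ← hδ, map_smul, sub_self]
  exact ⟨G, LinearMap.ext fun v => by rw [aeval_phiEnd_apply, hδ]⟩

end FiniteBase

end SkewRing

end

theorem mainTheorem3 {K L : Type*} [Field K] [Field L] [Algebra K L]
    [FiniteDimensional K L] [IsGalois K L]
    (σ : L ≃ₐ[K] L) (hσ : ∀ τ : L ≃ₐ[K] L, τ ∈ Subgroup.zpowers σ)
    (f : SkewRing σ) (h : ℕ) (hmonic : f.IsMonicOfDegree h) (hirr : Irreducible f)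
    (hf0 : f.coeff 0 ≠ 0)
    (F : Polynomial K) (hF : F.Monic) (hbound : f.IsBound (SkewRing.central σ F)) :
    (IsIntegral K f.phiPowBase ∧
      minpoly L f.phiPow = (minpoly K f.phiPowBase).map (algebraMap K L)) ∧
    ∃ m : ℕ, (SkewRing.central σ F).IsNumIrreducibleFactors m ∧ m ∣ Module.finrank K L ∧
      (f.matA h).charpoly = F.map (algebraMap K L) ^ (Module.finrank K L / m) ∧
      (Finite K → Module.finrank K L / m = 1) := by
  have hf := hmonic.hasDegree
  refine ⟨⟨SkewRing.isIntegral_phiPowBase hF hbound, by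
    rw [SkewRing.minpoly_phiPow hF hbound, SkewRing.minpoly_phiPowBase hF hbound]⟩, ?_⟩
  obtain ⟨m, ⟨e⟩⟩ := SkewRing.exists_linearEquiv_fun hf hirr hbound
  have hFirr := SkewRing.irreducible_of_isBound hf hirr hF hbound
  have hn : 0 < Module.finrank K L := Module.finrank_pos
  have hd : 0 < F.natDegree := hFirr.natDegree_pos
  have := SkewRing.isDomain_end hirr
  have := hf.finiteDimensional_end
  have hnd := SkewRing.finrank_mul_natDegree hf hF e
  have hnh := SkewRing.finrank_eq_mul_finrank_end hf hbound e
  rw [hf.finrank_base] at hnh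
  have hm : 0 < m := Nat.pos_of_mul_pos_right (hnd ▸ Nat.mul_pos hn hd)
  -- `c = dim_E D` for `D = End_R(R/Rf)` and `E = K[φ_fⁿ]`
  obtain ⟨c, hc⟩ := minpoly.natDegree_dvd_finrank (K := K) (SkewRing.phiEnd f)
  rw [SkewRing.minpoly_phiEnd hF hbound] at hc
  have hsq : Module.finrank K L ^ 2 = m ^ 2 * c := by
    refine Nat.eq_of_mul_eq_mul_right hd ?_
    calc Module.finrank K L ^ 2 * F.natDegree
        = m * (Module.finrank K L * h) := by rw [sq, mul_assoc, hnd]; ring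
      _ = m ^ 2 * c * F.natDegree := by rw [hnh, hc]; ring
  obtain ⟨l, hl⟩ : m ∣ Module.finrank K L := (Nat.pow_dvd_pow_iff two_ne_zero).1 ⟨c, hsq⟩
  have hdiv : Module.finrank K L / m = l := by rw [hl, Nat.mul_div_cancel_left _ hm]
  have hlh : l * F.natDegree = h := by
    refine Nat.eq_of_mul_eq_mul_left hm ?_
    rw [← hnd, hl, mul_assoc]
  have hcl : c = l ^ 2 := by
    refine Nat.eq_of_mul_eq_mul_left (pow_pos hm 2) ?_
    rw [← hsq, hl, mul_pow]
  have hlen := SkewRing.length_quotient_central hirr e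
  refine ⟨m, ⟨?_, fun l' hl' => ?_⟩, ⟨l, hl⟩, ?_, fun hK => ?_⟩
  · refine SkewRing.exists_isIrreducibleFactorization
      (SkewRing.hasDegree_central hF).ne_zero fun hu => ?_
    have := (SkewRing.hasDegree_central hF).unique (SkewRing.hasDegree_zero_iff_isUnit.2 hu)
    exact (Nat.mul_pos hn hd).ne' this
  · exact_mod_cast hl'.length_quotient.symm.trans hlen
  · obtain ⟨j, hj⟩ := SkewRing.exists_charpoly_matA_eq_pow hσ hmonic hirr hF hbound
    have hdeg := congrArg Polynomial.natDegree hj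
    rw [Matrix.charpoly_natDegree_eq_dim, Fintype.card_fin, (hF.map _).natDegree_pow,
      F.natDegree_map, ← hlh] at hdeg
    rw [hj, hdiv, Nat.eq_of_mul_eq_mul_right hd hdeg]
  · have hle := minpoly.finrank_le_natDegree_of_surjective (K := K) (SkewRing.phiEnd f)
      (SkewRing.exists_aeval_phiEnd_eq_of_finite hσ hf hirr hF hbound e)
    rw [SkewRing.minpoly_phiEnd hF hbound, hc, hcl] at hle
    have hl0 : 0 < l := Nat.pos_of_mul_pos_left (hl ▸ hn)
    have h2 : l ^ 2 ≤ 1 := by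
      by_contra! h2
      exact absurd hle (not_le.2 (by nlinarith))
    rw [hdiv]
    nlinarith
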